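/- Let $R$ be a commutative Noetherian ring, let $I,J$ be ideals of $R$, and put $$W(I,J)=\{\mathfrak p\in\operatorname{Spec}R \mid I^m\subseteq \mathfrak p+J\text{ for some integer } m\ge 1\}.$$ For an $R$-module $M$ let $\Gamma_{I,J}(M)=\{x\in M\mid \operatorname{Supp}_R(Rx)\subseteq W(I,J)\}$, and let $H^i_{I,J}$ be the $i$-th right derived functor of $\Gamma_{I,J}$. Let $\mathcal S$ be a Serre class of $R$-modules, that is, a class of $R$-modules containing the zero module and closed under submodules, quotients and extensions. Let $M$ be a finitely generated $R$-module and $n\ge 0$ an integer. Then the following statements are equivalent: 1. $H^i_{I,J}(M)\in\mathcal S$ for all $i>n$. 2. $H^i_{I,J}(N)\in\mathcal S$ for all $i>n$ and for every finitely generated $R$-module $N$ with $\operatorname{Supp}_R(N)\subseteq\operatorname{Supp}_R(M)$. 3. $H^i_{I,J}(R/\mathfrak p)\in\mathcal S$ for all $\mathfrak p\in\operatorname{Supp}_R(M)$ and all $i>n$. 4. $H^i_{I,J}(R/\mathfrak p)\in\mathcal S$ for all minimal elements $\mathfrak p$ of $\operatorname{Ass}_R(M)$ and all $i>n$. -/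

import Mathlib

open CategoryTheory

universe u

namespace PairCohomology

variable {R : Type u} [CommRing R]

/-- The set `W(I, J)` of primes `p` such that `I ^ n ⊆ p + J` for some `n ≥ 1`. -/
def W (I J : Ideal R) : Set (PrimeSpectrum R) :=
  {p | ∃ n : ℕ, 1 ≤ n ∧ I ^ n ≤ p.asIdeal ⊔ J}

theorem mem_support_span_singleton {M : Type u} [AddCommGroup M] [Module R M]
    (x : M) (p : PrimeSpectrum R) :
    p ∈ Module.support R (Submodule.span R {x}) ↔ ∀ r : R, r • x = 0 → r ∈ p.asIdeal := by
  rw [Module.mem_support_iff_exists_annihilator]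
  constructor
  · rintro ⟨⟨y, hy⟩, hp⟩ r hr
    obtain ⟨a, rfl⟩ := Submodule.mem_span_singleton.mp hy
    apply hp
    rw [Submodule.mem_annihilator_span_singleton]
    ext
    simp [smul_comm r a x, hr]
  · intro h
    refine ⟨⟨x, Submodule.mem_span_singleton_self x⟩, fun r hr => h r ?_⟩
    rw [Submodule.mem_annihilator_span_singleton] at hr
    simpa using congrArg Subtype.val hr

/-- The `(I, J)`-torsion submodule of `M`: all `x` with `Supp (R x) ⊆ W(I, J)`. -/
def torsion (I J : Ideal R) (M : Type u) [AddCommGroup M] [Module R M] : Submodule R M where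
  carrier := {x | Module.support R (Submodule.span R {x}) ⊆ W I J}
  zero_mem' := by
    intro p hp
    rw [mem_support_span_singleton] at hp
    exact absurd ((Ideal.eq_top_iff_one _).mpr (hp 1 (by simp))) p.isPrime.ne_top
  add_mem' := by
    intro x y hx hy p hp
    rw [mem_support_span_singleton] at hp
    by_cases h : p ∈ Module.support R (Submodule.span R {x})
    · exact hx h
    · apply hy
      rw [mem_support_span_singleton] at h ⊢
      push Not at h
      obtain ⟨r, hr, hrp⟩ := h
      intro s hs
      refine (p.isPrime.mem_or_mem (hp (r * s) ?_)).resolve_left hrp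
      rw [smul_add, mul_smul r s y, hs, mul_comm r s, mul_smul, hr]
      simp
  smul_mem' := by
    intro a x hx p hp
    apply hx
    rw [mem_support_span_singleton] at hp ⊢
    exact fun r hr => hp r (by rw [smul_comm, hr, smul_zero])

theorem map_mem_torsion (I J : Ideal R) {M N : Type u} [AddCommGroup M] [Module R M]
    [AddCommGroup N] [Module R N] (f : M →ₗ[R] N) {x : M} (hx : x ∈ torsion I J M) :
    f x ∈ torsion I J N := by
  intro p hp
  apply hx
  rw [mem_support_span_singleton] at hp ⊢
  exact fun r hr => hp r (by rw [← map_smul, hr, map_zero])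

/-- The `(I, J)`-torsion functor; a morphism is restricted to the torsion submodules. -/
def torsionFunctor (I J : Ideal R) : ModuleCat.{u} R ⥤ ModuleCat.{u} R where
  obj M := ModuleCat.of R (torsion I J M)
  map f := ModuleCat.ofHom (f.hom.restrict fun _ hx => map_mem_torsion I J f.hom hx)

instance (I J : Ideal R) : (torsionFunctor I J).Additive where

/-- The local cohomology functor `H^i_{I,J}` with respect to the pair `(I, J)`: the `i`-th right
derived functor of the `(I, J)`-torsion functor. -/
noncomputable def H (I J : Ideal R) (i : ℕ) : ModuleCat.{u} R ⥤ ModuleCat.{u} R :=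
  (torsionFunctor I J).rightDerived i

end PairCohomology

/-!
For a finite module `N`, membership of `H^i_{I,J}(N)` in the Serre class `S` follows by dévissage
from membership of `H^i_{I,J}(R ⧸ p)` for the primes `p` of `Supp N`, since `N` has a filtration
with factors `R ⧸ p` (`prop_H_of_forall_mem_support`). The heart of the matter is that the condition
on `M` in all degrees above `n` passes to every finite module `N` with `Supp N ⊆ Supp M`
(`prop_H_of_support_subset`); applied to `M` and to `R ⧸ q` for the minimal associated primes `q`
of `M`, which are the minimal primes of `Supp M`, it gives all the equivalences.

This is a descending induction on `i`. If `H^(i+1)` is in `S` on all such `N`, then `H^i` is right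
exact on them up to `S`. Given `p` in `Supp M`, there is a nonzero map `M → R ⧸ p`
(`exists_linearMap_quotient_ne_zero`). Its image `𝔞` is a quotient of `M`, so `H^i(𝔞) ∈ S`; the
cokernel is supported at primes strictly above `p`, which Noetherian induction handles; hence
`H^i(R ⧸ p) ∈ S`.

The induction starts because `H^i_{I,J} = 0` once `i` exceeds the number of generators of `I`
(`isZero_H_obj`). The `(I, J)`-torsion is the iterated torsion for the multiplicative sets
`{a ^ n + j}`, one for each generator `a` of `I`. Over a Noetherian ring the torsion of an injective
module for one multiplicative set is again injective, and injective modules surject onto their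
localizations, so each of these torsion functors delays exactness of a complex of injectives by at
most one degree.

The long exact sequence for right derived functors comes from the horseshoe lemma, with the
resolution of the middle term built as a twisted direct sum of those of the outer terms.
-/

/-! ### The horseshoe lemma and the long exact sequence of derived functors -/

namespace CategoryTheory.InjectiveResolution

open Limits

universe v w

variable {C : Type w} [Category.{v} C] [Abelian C]

/-- The augmentation of an injective resolution, with source `Z` itself. -/
theorem exists_augmentation {Z : C} (I : InjectiveResolution Z) :
    ∃ (e : Z ⟶ I.cocomplex.X 0) (w : e ≫ I.cocomplex.d 0 1 = 0),
      Mono e ∧ (ShortComplex.mk e _ w).Exact :=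
  have h : Mono (I.ι.f 0) := inferInstance
  ⟨I.ι.f 0, I.ι_f_zero_comp_complex_d, h, I.exact₀⟩

/-- An exact augmented complex of injectives is an injective resolution. -/
theorem exists_of_augmentation {Z : C} (X : CochainComplex C ℕ) (hX : ∀ n, Injective (X.X n))
    (e : Z ⟶ X.X 0) (_ : Mono e) (w : e ≫ X.d 0 1 = 0) (he : (ShortComplex.mk e _ w).Exact)
    (h : ∀ n, X.ExactAt (n + 1)) : ∃ I : InjectiveResolution Z, I.cocomplex = X :=
  ⟨{  cocomplex := X
      injective := hX
      ι := (CochainComplex.fromSingle₀Equiv _ _).symm ⟨e, w⟩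
      quasiIso := ⟨fun n => by
        cases n with
        | zero =>
          rw [CochainComplex.quasiIsoAt₀_iff, ShortComplex.quasiIso_iff_of_zeros]
          · refine (ShortComplex.exact_and_mono_f_iff_of_iso ?_).2
              ⟨he, by dsimp; infer_instance⟩
            refine ShortComplex.isoMk (Iso.refl _) (Iso.refl _) (Iso.refl _) ?_ ?_
            · exact (Category.id_comp _).trans ((CochainComplex.fromSingle₀Equiv_symm_apply_f_zero
                e w).symm.trans (Category.comp_id _).symm)
            · exact (Category.id_comp _).trans (Category.comp_id _).symm
          · rfl
          · rfl
          · exact X.shape _ _ (by simp)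
        | succ n =>
          rw [quasiIsoAt_iff_exactAt]
          · exact h n
          · exact CochainComplex.exactAt_succ_single_obj _ _⟩ }, rfl⟩

/-- A short exact sequence is encoded, on the level of resolutions of its outer terms, by an
extension `β` of the augmentation of the first one to the middle term, and a family `τ` of
morphisms that anticommute with the differentials. -/
theorem exists_twisting {S : ShortComplex C} (hS : S.ShortExact)
    (I : InjectiveResolution S.X₁) (K : InjectiveResolution S.X₃)
    (a : S.X₁ ⟶ I.cocomplex.X 0) [Mono a] (ha : a ≫ I.cocomplex.d 0 1 = 0)
    (c : S.X₃ ⟶ K.cocomplex.X 0) [Mono c] (hc : c ≫ K.cocomplex.d 0 1 = 0)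
    (hc' : (ShortComplex.mk c _ hc).Exact) :
    ∃ (β : S.X₂ ⟶ I.cocomplex.X 0) (τ : ∀ n, K.cocomplex.X n ⟶ I.cocomplex.X (n + 1)),
      S.f ≫ β = a ∧ S.g ≫ c ≫ τ 0 = -(β ≫ I.cocomplex.d 0 1) ∧
      ∀ n, K.cocomplex.d n (n + 1) ≫ τ (n + 1) =
        -(τ n ≫ I.cocomplex.d (n + 1) (n + 1 + 1)) := by
  have := hS.mono_f
  have := hS.epi_g
  let β : S.X₂ ⟶ I.cocomplex.X 0 := Injective.factorThru a S.f
  have hβ : S.f ≫ β = a := Injective.comp_factorThru _ _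
  have hex₀ : (ShortComplex.mk S.f (S.g ≫ c) (by simp)).Exact :=
    (ShortComplex.exact_iff_of_epi_of_isIso_of_mono
      (S₁ := S) (S₂ := ShortComplex.mk S.f (S.g ≫ c) (by simp))
      { τ₁ := 𝟙 _, τ₂ := 𝟙 _, τ₃ := c }).1 hS.exact
  have hf : S.f ≫ (-(β ≫ I.cocomplex.d 0 1)) = 0 := by
    rw [Preadditive.comp_neg, reassoc_of% hβ, ha, neg_zero]
  obtain ⟨τ₀, hτ₀⟩ : ∃ τ₀ : K.cocomplex.X 0 ⟶ I.cocomplex.X 1,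
      (S.g ≫ c) ≫ τ₀ = -(β ≫ I.cocomplex.d 0 1) :=
    ⟨hex₀.descToInjective _ hf, hex₀.comp_descToInjective _ hf⟩
  have hf₁ : c ≫ (-(τ₀ ≫ I.cocomplex.d 1 2)) = 0 := by
    rw [← cancel_epi S.g, Preadditive.comp_neg, Preadditive.comp_neg, ← Category.assoc,
      ← Category.assoc, hτ₀]
    simp
  obtain ⟨τ₁, hτ₁⟩ : ∃ τ₁ : K.cocomplex.X 1 ⟶ I.cocomplex.X 2,
      K.cocomplex.d 0 1 ≫ τ₁ = -(τ₀ ≫ I.cocomplex.d 1 2) :=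
    ⟨hc'.descToInjective _ hf₁, hc'.comp_descToInjective _ hf₁⟩
  -- Two consecutive components are carried along, since the relation between them is what
  -- makes the next component exist.
  let P : ℕ → Type v := fun n =>
    { t : (K.cocomplex.X n ⟶ I.cocomplex.X (n + 1)) ×
          (K.cocomplex.X (n + 1) ⟶ I.cocomplex.X (n + 1 + 1)) //
        K.cocomplex.d n (n + 1) ≫ t.2 = -(t.1 ≫ I.cocomplex.d (n + 1) (n + 1 + 1)) }
  have step : ∀ n (t : P n), ∃ t' : P (n + 1), t'.1.1 = t.1.2 := by
    rintro n ⟨⟨a, b⟩, hab⟩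
    have hb : K.cocomplex.d n (n + 1) ≫
        (-(b ≫ I.cocomplex.d (n + 1 + 1) (n + 1 + 1 + 1))) = 0 := by
      dsimp at hab
      rw [Preadditive.comp_neg, reassoc_of% hab]
      simp
    exact ⟨⟨⟨b, (K.exact_succ n).descToInjective _ hb⟩,
      (K.exact_succ n).comp_descToInjective _ hb⟩, rfl⟩
  choose next hnext using step
  let T : ∀ n, P n := fun n => Nat.rec ⟨⟨τ₀, τ₁⟩, hτ₁⟩ next n
  refine ⟨β, fun n => (T n).1.1, hβ, by rw [← Category.assoc]; exact hτ₀, fun n => ?_⟩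
  have h : (T (n + 1)).1.1 = (T n).1.2 := hnext n (T n)
  beta_reduce
  rw [h]
  exact (T n).2

section Twisted

variable (I K : CochainComplex C ℕ) (τ : ∀ n, K.X n ⟶ I.X (n + 1))
  (hτ : ∀ n, K.d n (n + 1) ≫ τ (n + 1) = -(τ n ≫ I.d (n + 1) (n + 1 + 1)))

/-- The upper triangular differential with off-diagonal entry `τ`. -/
noncomputable def twistedSumD (n : ℕ) : I.X n ⊞ K.X n ⟶ I.X (n + 1) ⊞ K.X (n + 1) :=
  biprod.desc (I.d n (n + 1) ≫ biprod.inl) (biprod.lift (τ n) (K.d n (n + 1)))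

/-- The complex with terms `I.X n ⊞ K.X n` and differential `twistedSumD`. -/
noncomputable def twistedSum : CochainComplex C ℕ :=
  CochainComplex.of (fun n => I.X n ⊞ K.X n) (twistedSumD I K τ) (fun n => by
    apply biprod.hom_ext'
    · simp [twistedSumD]
    · apply biprod.hom_ext <;> simp [twistedSumD, biprod.lift_desc, hτ])

theorem twistedSum_d (n : ℕ) : (twistedSum I K τ hτ).d n (n + 1) = twistedSumD I K τ n :=
  CochainComplex.of_d (fun n => I.X n ⊞ K.X n) (twistedSumD I K τ) n

/-- The degreewise split short complex `I ⟶ twistedSum ⟶ K`. -/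
noncomputable def twistedSumShortComplex : ShortComplex (CochainComplex C ℕ) where
  X₁ := I
  X₂ := twistedSum I K τ hτ
  X₃ := K
  f :=
    { f := fun n => (biprod.inl : I.X n ⟶ I.X n ⊞ K.X n)
      comm' := by
        rintro i j rfl
        rw [twistedSum_d]
        exact biprod.inl_desc _ _ }
  g :=
    { f := fun n => (biprod.snd : I.X n ⊞ K.X n ⟶ K.X n)
      comm' := by
        rintro i j rfl
        rw [twistedSum_d]
        have h : biprod.snd ≫ K.d i (i + 1) = twistedSumD I K τ i ≫ biprod.snd := by
          apply biprod.hom_ext' <;> simp [twistedSumD]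
        exact h }
  zero := by
    ext n
    exact biprod.inl_snd

/-- The degreewise splitting. -/
noncomputable def twistedSumSplitting (n : ℕ) :
    ((twistedSumShortComplex I K τ hτ).map (HomologicalComplex.eval C _ n)).Splitting where
  r := (biprod.fst : I.X n ⊞ K.X n ⟶ I.X n)
  s := (biprod.inr : K.X n ⟶ I.X n ⊞ K.X n)
  f_r := biprod.inl_fst
  s_g := biprod.inr_snd
  id := biprod.total

theorem twistedSumShortComplex_shortExact : (twistedSumShortComplex I K τ hτ).ShortExact :=
  HomologicalComplex.shortExact_of_degreewise_shortExact _
    fun n => (twistedSumSplitting I K τ hτ n).shortExact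

end Twisted

/-- Exactness at degree zero of the augmented complex in the horseshoe lemma. -/
theorem exact_biprod_augmentation {S : ShortComplex C} (hS : S.ShortExact) {I₀ I₁ K₀ K₁ : C}
    {dI : I₀ ⟶ I₁} {dK : K₀ ⟶ K₁} {a : S.X₁ ⟶ I₀} {c : S.X₃ ⟶ K₀} [Mono a] [Mono c]
    {ha : a ≫ dI = 0} {hc : c ≫ dK = 0}
    (ha' : (ShortComplex.mk a dI ha).Exact) (hc' : (ShortComplex.mk c dK hc).Exact)
    {β : S.X₂ ⟶ I₀} {τ : K₀ ⟶ I₁} (hβ : S.f ≫ β = a) (hτ : S.g ≫ c ≫ τ = -(β ≫ dI)) :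
    ∃ w, Mono (biprod.lift β (S.g ≫ c)) ∧ (ShortComplex.mk (biprod.lift β (S.g ≫ c))
      (biprod.desc (dI ≫ biprod.inl) (biprod.lift τ dK)) w).Exact := by
  have := hS.mono_f
  have := hS.epi_g
  refine ⟨?_, ?_, ?_⟩
  · apply biprod.hom_ext <;> simp [biprod.lift_desc, hτ, hc]
  · rw [Preadditive.mono_iff_cancel_zero]
    intro P t ht
    have h1 : t ≫ β = 0 := by
      simpa using congr($ht ≫ biprod.fst)
    have h2 : t ≫ S.g = 0 := by
      rw [← cancel_mono c]
      simpa using congr($ht ≫ biprod.snd)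
    have h3 : hS.exact.lift t h2 ≫ a = 0 := by
      rw [← hβ, ← Category.assoc, hS.exact.lift_f, h1]
    rw [← hS.exact.lift_f t h2, zero_of_comp_mono _ h3, zero_comp]
  · rw [ShortComplex.exact_iff_exact_up_to_refinements]
    intro A x hx
    dsimp at x hx
    obtain ⟨y, z, rfl⟩ : ∃ y z, x = biprod.lift y z :=
      ⟨x ≫ biprod.fst, x ≫ biprod.snd, by apply biprod.hom_ext <;> simp⟩
    rw [biprod.lift_desc] at hx
    have hz : z ≫ dK = 0 := by simpa using congr($hx ≫ biprod.snd)
    have hy : y ≫ dI + z ≫ τ = 0 := by simpa using congr($hx ≫ biprod.fst)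
    obtain ⟨z', rfl⟩ : ∃ z', z' ≫ c = z := ⟨hc'.lift z hz, hc'.lift_f z hz⟩
    obtain ⟨A', π, hπ, b, hb⟩ := surjective_up_to_refinements_of_epi S.g z'
    have hd : (π ≫ y - b ≫ β) ≫ dI = 0 := by
      have h1 : y ≫ dI = -((z' ≫ c) ≫ τ) := eq_neg_of_add_eq_zero_left hy
      have h2 : β ≫ dI = -(S.g ≫ c ≫ τ) := by rw [hτ, neg_neg]
      rw [Preadditive.sub_comp, Category.assoc, Category.assoc, h1, h2,
        Preadditive.comp_neg, Preadditive.comp_neg, Category.assoc, reassoc_of% hb, sub_self]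
    obtain ⟨s, hs⟩ : ∃ s, s ≫ a = π ≫ y - b ≫ β := ⟨ha'.lift _ hd, ha'.lift_f _ hd⟩
    refine ⟨A', π, hπ, b + s ≫ S.f, ?_⟩
    apply biprod.hom_ext <;> simp [hβ, hs, reassoc_of% hb]

/-- The horseshoe lemma: injective resolutions of the outer terms of a short exact sequence fit
into a degreewise split short exact sequence with a resolution of the middle term. -/
theorem horseshoe {S : ShortComplex C} (hS : S.ShortExact)
    (I : InjectiveResolution S.X₁) (K : InjectiveResolution S.X₃) :
    ∃ (X : InjectiveResolution S.X₂) (f : I.cocomplex ⟶ X.cocomplex)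
      (g : X.cocomplex ⟶ K.cocomplex) (w : f ≫ g = 0),
      ∀ n, Nonempty (((ShortComplex.mk f g w).map
        (HomologicalComplex.eval C _ n)).Splitting) := by
  obtain ⟨a, ha, _, ha'⟩ := I.exists_augmentation
  obtain ⟨c, hc, _, hc'⟩ := K.exists_augmentation
  obtain ⟨β, τ, hβ, hβτ, hτ⟩ := exists_twisting hS I K a ha c hc hc'
  obtain ⟨w, hmono, hex⟩ := exact_biprod_augmentation hS ha' hc' hβ hβτ
  have hd : _ = biprod.desc _ _ := twistedSum_d I.cocomplex K.cocomplex τ hτ 0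
  have hSE := twistedSumShortComplex_shortExact I.cocomplex K.cocomplex τ hτ
  have hexact : ∀ n, (twistedSum I.cocomplex K.cocomplex τ hτ).ExactAt (n + 1) := by
    intro n
    rw [HomologicalComplex.exactAt_iff_isZero_homology]
    refine (hSE.homology_exact₂ (n + 1)).isZero_of_both_zeros ?_ ?_
    · exact ((HomologicalComplex.exactAt_iff_isZero_homology _ _).1
        (I.cocomplex_exactAt_succ n)).eq_of_src _ _
    · exact ((HomologicalComplex.exactAt_iff_isZero_homology _ _).1
        (K.cocomplex_exactAt_succ n)).eq_of_tgt _ _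
  obtain ⟨X, hX⟩ := exists_of_augmentation (twistedSum I.cocomplex K.cocomplex τ hτ)
    (fun n => inferInstanceAs (Injective (I.cocomplex.X n ⊞ K.cocomplex.X n)))
    (biprod.lift β (S.g ≫ c)) hmono (by rw [hd]; exact w)
    (by
      have key : ∀ d (hd : d = biprod.desc (I.cocomplex.d 0 1 ≫ biprod.inl)
          (biprod.lift (τ 0) (K.cocomplex.d 0 1))) (w : biprod.lift β (S.g ≫ c) ≫ d = 0),
          (ShortComplex.mk (biprod.lift β (S.g ≫ c)) d w).Exact := by
        rintro _ rfl _
        exact hex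
      exact key _ hd _)
    hexact
  refine ⟨X, ?_⟩
  rw [hX]
  exact ⟨(twistedSumShortComplex I.cocomplex K.cocomplex τ hτ).f,
    (twistedSumShortComplex I.cocomplex K.cocomplex τ hτ).g,
    (twistedSumShortComplex I.cocomplex K.cocomplex τ hτ).zero,
    fun n => ⟨twistedSumSplitting I.cocomplex K.cocomplex τ hτ n⟩⟩

end CategoryTheory.InjectiveResolution

namespace CategoryTheory.Functor

open Limits

universe v w v' w'

variable {C : Type w} [Category.{v} C] [Abelian C] [HasInjectiveResolutions C]
  {D : Type w'} [Category.{v'} D] [Abelian D] (F : C ⥤ D) [F.Additive]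
  (P : ObjectProperty D) [P.IsSerreClass]

/-- The right derived functors on the terms of a short exact sequence are the homology of the terms
of a short exact sequence of complexes. -/
theorem exists_shortExact_homologyIso_rightDerived {S : ShortComplex C} (hS : S.ShortExact) :
    ∃ T : ShortComplex (CochainComplex D ℕ), T.ShortExact ∧ ∀ i,
      Nonempty ((F.rightDerived i).obj S.X₁ ≅ T.X₁.homology i) ∧
      Nonempty ((F.rightDerived i).obj S.X₂ ≅ T.X₂.homology i) ∧
      Nonempty ((F.rightDerived i).obj S.X₃ ≅ T.X₃.homology i) := by
  obtain ⟨I⟩ := HasInjectiveResolution.out (Z := S.X₁)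
  obtain ⟨K⟩ := HasInjectiveResolution.out (Z := S.X₃)
  obtain ⟨X, f, g, w, h⟩ := InjectiveResolution.horseshoe hS I K
  refine ⟨(ShortComplex.mk f g w).map (F.mapHomologicalComplex _), ?_, fun i =>
    ⟨⟨I.isoRightDerivedObj F i⟩, ⟨X.isoRightDerivedObj F i⟩, ⟨K.isoRightDerivedObj F i⟩⟩⟩
  exact HomologicalComplex.shortExact_of_degreewise_shortExact _
    fun n => ((h n).some.map F).shortExact

theorem prop_rightDerived_X₂ {S : ShortComplex C} (hS : S.ShortExact) (i : ℕ)
    (h₁ : P ((F.rightDerived i).obj S.X₁)) (h₃ : P ((F.rightDerived i).obj S.X₃)) :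
    P ((F.rightDerived i).obj S.X₂) := by
  obtain ⟨T, hT, e⟩ := F.exists_shortExact_homologyIso_rightDerived hS
  obtain ⟨⟨e₁⟩, ⟨e₂⟩, ⟨e₃⟩⟩ := e i
  exact P.prop_of_iso e₂.symm (P.prop_X₂_of_exact (hT.homology_exact₂ i)
    (P.prop_of_iso e₁ h₁) (P.prop_of_iso e₃ h₃))

theorem prop_rightDerived_X₃ {S : ShortComplex C} (hS : S.ShortExact) (i : ℕ)
    (h₂ : P ((F.rightDerived i).obj S.X₂)) (h₁ : P ((F.rightDerived (i + 1)).obj S.X₁)) :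
    P ((F.rightDerived i).obj S.X₃) := by
  obtain ⟨T, hT, e⟩ := F.exists_shortExact_homologyIso_rightDerived hS
  obtain ⟨-, ⟨e₂⟩, ⟨e₃⟩⟩ := e i
  obtain ⟨⟨e₁⟩, -, -⟩ := e (i + 1)
  exact P.prop_of_iso e₃.symm (P.prop_X₂_of_exact (hT.homology_exact₃ i (i + 1) rfl)
    (P.prop_of_iso e₂ h₂) (P.prop_of_iso e₁ h₁))

end CategoryTheory.Functor

/-! ### Torsion in injective modules over a Noetherian ring -/

namespace PairCohomology

section Baer

variable {R : Type*} [CommRing R] {M : Type*} [AddCommGroup M] [Module R M]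

/-- Baer's criterion for a submodule `N` of `M`, with maps into `N` written as maps into `M`. -/
def IsBaer (N : Submodule R M) : Prop :=
  ∀ (𝔞 : Ideal R) (g : 𝔞 →ₗ[R] M), (∀ y, g y ∈ N) → ∃ x ∈ N, ∀ y : 𝔞, g y = (y : R) • x

theorem isBaer_top (h : Module.Baer R M) : IsBaer (⊤ : Submodule R M) := by
  intro 𝔞 g _
  obtain ⟨g', hg'⟩ := h 𝔞 g
  refine ⟨g' 1, trivial, fun y => ?_⟩
  rw [← hg' y y.2, ← map_smul, smul_eq_mul, mul_one]

theorem exists_smul_eq_zero_of_finite {P : Type*} [AddCommGroup P] [Module R P]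
    [Module.Finite R P] (S : Submonoid R) (g : P →ₗ[R] M) (hg : ∀ y, ∃ s ∈ S, s • g y = 0) :
    ∃ s ∈ S, ∀ y, s • g y = 0 := by
  obtain ⟨t, ht⟩ := Module.Finite.fg_top (R := R) (M := P)
  choose s hs hsg using hg
  refine ⟨∏ y ∈ t, s y, S.prod_mem fun y _ => hs y, fun y => ?_⟩
  have hy : y ∈ Submodule.span R (t : Set P) := ht ▸ trivial
  induction hy using Submodule.span_induction with
  | mem y hy =>
    obtain ⟨c, hc⟩ := Finset.dvd_prod_of_mem s (Finset.mem_coe.1 hy)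
    rw [hc, mul_comm, mul_smul, hsg, smul_zero]
  | zero => simp
  | add y z _ _ hy hz => rw [map_add, smul_add, hy, hz, add_zero]
  | smul r y _ hy => rw [map_smul, smul_comm, hy, smul_zero]

variable [IsNoetherianRing R]

/-- The Artin–Rees lemma for a principal ideal `(s)` and an ideal `𝔞`. -/
theorem exists_pow_mul_mem (𝔞 : Ideal R) (s : R) :
    ∃ k : ℕ, ∀ r, r * s ^ k ∈ 𝔞 → ∃ y ∈ 𝔞, r * s ^ k = s * y := by
  obtain ⟨k, hk⟩ := Ideal.exists_pow_inf_eq_pow_smul (Ideal.span {s}) (M := R) 𝔞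
  refine ⟨k + 1, fun r hr => ?_⟩
  have hmem : r * s ^ (k + 1) ∈ Ideal.span {s} ^ (k + 1) • (⊤ : Submodule R R) ⊓ 𝔞 := by
    refine ⟨?_, hr⟩
    rw [Ideal.span_singleton_pow, smul_eq_mul, Ideal.mul_top]
    exact Ideal.mul_mem_left _ _ (Ideal.mem_span_singleton_self _)
  rw [hk (k + 1) (Nat.le_succ k), Nat.add_sub_cancel_left, pow_one, smul_eq_mul,
    Ideal.mem_span_singleton_mul] at hmem
  obtain ⟨y, hy, hys⟩ := hmem
  exact ⟨y, hy.2, hys.symm⟩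

/-- Over a Noetherian ring, the `S`-torsion of an injective module is injective. -/
theorem IsBaer.inf_torsion' {N : Submodule R M} (hN : IsBaer N) (S : Submonoid R) :
    IsBaer (N ⊓ Submodule.torsion' R M S) := by
  intro 𝔞 g hg
  obtain ⟨s, hsS, hs⟩ := exists_smul_eq_zero_of_finite S g fun y => by
    obtain ⟨a, ha⟩ := (Submodule.mem_torsion'_iff (M := M) S _).1 (hg y).2
    exact ⟨a, a.2, ha⟩
  obtain ⟨x, hxN, hx⟩ := hN 𝔞 g fun y => (hg y).1
  obtain ⟨k, hk⟩ := exists_pow_mul_mem 𝔞 s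
  -- The element `x` is corrected by some `z` killed by `𝔞` with `s ^ k • z = s ^ k • x`. Such a
  -- `z` represents the map on `𝔞 + (s ^ k)` that is `0` on `𝔞` and multiplication by `x` on
  -- `(s ^ k)`, which is well defined since `g` vanishes on `s 𝔞`.
  let f₁ : R →ₗ.[R] M := ⟨𝔞, 0⟩
  let f₂ : R →ₗ.[R] M := ⟨Ideal.span {s ^ k},
    (LinearMap.toSpanSingleton R M x).comp (Submodule.subtype _)⟩
  have hcompat : ∀ (a : f₁.domain) (b : f₂.domain), (a : R) = b → f₁ a = f₂ b := by
    rintro ⟨a, ha⟩ ⟨b, hb⟩ rfl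
    obtain ⟨r, rfl⟩ := Ideal.mem_span_singleton'.1 hb
    obtain ⟨y, hy, hry⟩ := hk r ha
    change 0 = (r * s ^ k) • x
    rw [hry, mul_smul, ← hx ⟨y, hy⟩, hs]
  have hval : ∀ (a : f₁.domain) (b : f₂.domain) (c : (f₁.sup f₂ hcompat).domain),
      (a : R) + b = c → (f₁.sup f₂ hcompat) c = (b : R) • x := by
    intro a b c habc
    rw [LinearPMap.sup_apply hcompat a b c habc]
    exact zero_add _
  obtain ⟨z, hzN, hz⟩ := hN (𝔞 ⊔ Ideal.span {s ^ k}) (f₁.sup f₂ hcompat).toFun (by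
    rintro ⟨c, hc⟩
    obtain ⟨a, ha, b, hb, rfl⟩ := Submodule.mem_sup.1 hc
    exact (congrArg (· ∈ N) (hval ⟨a, ha⟩ ⟨b, hb⟩ ⟨a + b, hc⟩ rfl)).mpr (N.smul_mem b hxN))
  have hz₁ : ∀ y ∈ 𝔞, y • z = 0 := by
    intro y hy
    have hy' : y ∈ 𝔞 ⊔ Ideal.span {s ^ k} := Ideal.mem_sup_left hy
    have h := hval ⟨y, hy⟩ ⟨0, zero_mem _⟩ ⟨y, hy'⟩ (add_zero _)
    exact (hz ⟨y, hy'⟩).symm.trans (h.trans (zero_smul _ _))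
  have hz₂ : s ^ k • z = s ^ k • x := by
    have hs' : s ^ k ∈ 𝔞 ⊔ Ideal.span {s ^ k} :=
      Ideal.mem_sup_right (Ideal.mem_span_singleton_self _)
    have h := hval ⟨0, zero_mem _⟩ ⟨s ^ k, Ideal.mem_span_singleton_self _⟩ ⟨s ^ k, hs'⟩
      (zero_add _)
    exact (hz ⟨s ^ k, hs'⟩).symm.trans h
  refine ⟨x - z, ⟨N.sub_mem hxN hzN, ?_⟩, fun y => ?_⟩
  · rw [SetLike.mem_coe, Submodule.mem_torsion'_iff]
    refine ⟨⟨s ^ k, S.pow_mem hsS k⟩, ?_⟩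
    change s ^ k • (x - z) = 0
    rw [smul_sub, hz₂, sub_self]
  · rw [smul_sub, hz₁ y y.2, sub_zero, hx]

/-- Every fraction `x / s` with numerator in an injective module over a Noetherian ring equals
`y / 1` for some `y`, so an injective module surjects onto its localizations. -/
theorem IsBaer.exists_pow_smul_eq {N : Submodule R M} (hN : IsBaer N) (s : R) {x : M}
    (hx : x ∈ N) : ∃ k : ℕ, ∃ y ∈ N, s ^ (k + 1) • y = s ^ k • x := by
  obtain ⟨k, hk⟩ := monotone_stabilizes_iff_noetherian.2 (inferInstanceAs (IsNoetherian R R))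
    { toFun := fun n => Ideal.torsionOf R R (s ^ n)
      monotone' := monotone_nat_of_le_succ fun n r hr => by
        rw [Ideal.mem_torsionOf_iff] at hr ⊢
        rw [pow_succ, ← smul_mul_assoc, hr, zero_mul] }
  have hann : ∀ r : R, r • s ^ (k + 1) = 0 → r • s ^ k • x = 0 := by
    intro r hr
    have h : r ∈ Ideal.torsionOf R R (s ^ k) := by
      have := hk (k + 1) (Nat.le_succ k)
      change Ideal.torsionOf R R (s ^ k) = Ideal.torsionOf R R (s ^ (k + 1)) at this
      rwa [this, Ideal.mem_torsionOf_iff]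
    rw [Ideal.mem_torsionOf_iff] at h
    rw [← smul_assoc, h, zero_smul]
  let f : R →ₗ.[R] M := LinearPMap.mkSpanSingleton' (s ^ (k + 1)) (s ^ k • x) hann
  have hf : ∀ (r : R) (h : r • s ^ (k + 1) ∈ f.domain),
      f.toFun ⟨r • s ^ (k + 1), h⟩ = r • s ^ k • x :=
    fun r h => LinearPMap.mkSpanSingleton'_apply _ _ hann r h
  obtain ⟨y, hyN, hy⟩ := hN f.domain f.toFun (by
    rintro ⟨c, hc⟩
    obtain ⟨r, rfl⟩ := Submodule.mem_span_singleton.1 hc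
    rw [hf]
    exact N.smul_mem _ (N.smul_mem _ hx))
  refine ⟨k, y, hyN, ?_⟩
  have hmem : (1 : R) • s ^ (k + 1) ∈ f.domain :=
    Submodule.smul_mem _ _ (Submodule.mem_span_singleton_self _)
  have h := hy ⟨_, hmem⟩
  rw [hf] at h
  simpa using h.symm

end Baer

section Iterated

variable {R : Type*} [CommRing R]

/-- The elements of `M` that are torsion for each of the multiplicative sets in a list. -/
def listTorsion (M : Type*) [AddCommGroup M] [Module R M] : List (Submonoid R) → Submodule R M
  | [] => ⊤
  | S :: L => listTorsion M L ⊓ Submodule.torsion' R M S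

theorem mem_listTorsion {M : Type*} [AddCommGroup M] [Module R M] (L : List (Submonoid R))
    (x : M) : x ∈ listTorsion M L ↔ ∀ S ∈ L, ∃ s ∈ S, s • x = 0 := by
  induction L with
  | nil => simp [listTorsion]
  | cons S L ih =>
    rw [listTorsion, Submodule.mem_inf, ih, Submodule.mem_torsion'_iff, List.forall_mem_cons,
      and_comm]
    exact and_congr_left' ⟨fun ⟨a, ha⟩ => ⟨a, a.2, ha⟩, fun ⟨a, h, ha⟩ => ⟨⟨a, h⟩, ha⟩⟩

theorem map_mem_listTorsion {M N : Type*} [AddCommGroup M] [Module R M] [AddCommGroup N]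
    [Module R N] (f : M →ₗ[R] N) (L : List (Submonoid R)) {x : M} (hx : x ∈ listTorsion M L) :
    f x ∈ listTorsion N L := by
  rw [mem_listTorsion] at hx ⊢
  intro S hS
  obtain ⟨s, hs, h⟩ := hx S hS
  exact ⟨s, hs, by rw [← map_smul, h, map_zero]⟩

theorem isBaer_listTorsion [IsNoetherianRing R] {M : Type*} [AddCommGroup M] [Module R M]
    (h : Module.Baer R M) (L : List (Submonoid R)) : IsBaer (listTorsion M L) := by
  induction L with
  | nil => exact isBaer_top h
  | cons S L ih => exact ih.inf_torsion' S

/-- Passing to the torsion of a complex of injectives for one more multiplicative set shifts the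
range in which it is exact by at most one. -/
theorem exists_mem_listTorsion_of_exact [IsNoetherianRing R] {E : ℕ → Type*}
    [∀ i, AddCommGroup (E i)] [∀ i, Module R (E i)] (d : ∀ i, E i →ₗ[R] E (i + 1))
    (hE : ∀ i, Module.Baer R (E i)) (hdd : ∀ i x, d (i + 1) (d i x) = 0)
    (hex : ∀ i x, d (i + 1) x = 0 → ∃ y, d i y = x) (L : List (Submonoid R)) :
    ∀ i, L.length ≤ i → ∀ x ∈ listTorsion (E (i + 1)) L, d (i + 1) x = 0 →
      ∃ y ∈ listTorsion (E i) L, d i y = x := by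
  induction L with
  | nil => exact fun i _ x _ hx => (hex i x hx).imp fun y hy => ⟨trivial, hy⟩
  | cons S L ih =>
    rintro (_ | j) hi x ⟨hxL, hxS⟩ hx
    · simp at hi
    have hj : L.length ≤ j := by simpa using hi
    obtain ⟨y, hyL, hy⟩ := ih (j + 1) (by lia) x hxL hx
    obtain ⟨⟨s, hs⟩, hsx⟩ := (Submodule.mem_torsion'_iff (M := E (j + 1 + 1)) S _).1 hxS
    replace hsx : s • x = 0 := hsx
    -- The image of `y` in the localization at `S` is a cocycle, hence a coboundary, and the
    -- element bounding it lifts to `z'`.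
    obtain ⟨z, hzL, hz⟩ := ih j hj (s • y) (Submodule.smul_mem _ _ hyL)
      (by rw [map_smul, hy, hsx])
    obtain ⟨k, z', hz'L, hz'⟩ := (isBaer_listTorsion (hE j) L).exists_pow_smul_eq s hzL
    refine ⟨y - d j z', ⟨Submodule.sub_mem _ hyL (map_mem_listTorsion _ L hz'L), ?_⟩, ?_⟩
    · rw [SetLike.mem_coe, Submodule.mem_torsion'_iff]
      refine ⟨⟨s ^ (k + 1), S.pow_mem hs _⟩, ?_⟩
      change s ^ (k + 1) • (y - d j z') = 0
      rw [smul_sub, ← map_smul, hz', map_smul, hz, smul_smul, ← pow_succ, sub_self]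
    · rw [map_sub, hy, hdd, sub_zero]

end Iterated

/-! ### Vanishing of the cohomology in large degrees -/

section Vanishing

variable {R : Type u} [CommRing R]

/-- The multiplicative set of all `a ^ n + j` with `j ∈ J`. -/
def powAdd (J : Ideal R) (a : R) : Submonoid R :=
  (Submonoid.powers (Ideal.Quotient.mk J a)).comap (Ideal.Quotient.mk J)

theorem mem_powAdd {J : Ideal R} {a s : R} : s ∈ powAdd J a ↔ ∃ n : ℕ, a ^ n - s ∈ J := by
  simp only [powAdd, Submonoid.mem_comap, Submonoid.mem_powers_iff, ← map_pow,
    Ideal.Quotient.eq]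

/-- The torsion condition on primes, rephrased with multiplicative sets, one for each generator of
`I`: both say that a power of `I` lies in `Ann x + J`. -/
theorem mem_torsion_span_iff {M : Type u} [AddCommGroup M] [Module R M] (t : Finset R)
    (J : Ideal R) (x : M) : x ∈ torsion (Ideal.span (t : Set R)) J M ↔
      ∀ a ∈ t, ∃ s ∈ powAdd J a, s • x = 0 := by
  constructor
  · intro hx a ha
    have hrad : a ∈ (Ideal.torsionOf R M x ⊔ J).radical := by
      rw [Ideal.radical_eq_sInf, Submodule.mem_sInf]
      rintro p ⟨hle, hp⟩
      obtain ⟨n, -, hn⟩ := hx ((mem_support_span_singleton x ⟨p, hp⟩).2 fun r hr =>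
        hle (Ideal.mem_sup_left ((Ideal.mem_torsionOf_iff x r).2 hr)))
      have := hn (Ideal.pow_mem_pow (Ideal.subset_span ha) n)
      rw [sup_eq_left.2 (le_sup_right.trans hle)] at this
      exact hp.mem_of_pow_mem n this
    obtain ⟨n, hn⟩ := hrad
    obtain ⟨s, hs, j, hj, hsj⟩ := Submodule.mem_sup.1 hn
    exact ⟨s, mem_powAdd.2 ⟨n, by rwa [← hsj, add_sub_cancel_left]⟩,
      (Ideal.mem_torsionOf_iff x s).1 hs⟩
  · intro hx p hp
    rw [mem_support_span_singleton] at hp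
    have hle : Ideal.span (t : Set R) ≤ (p.asIdeal ⊔ J).radical := by
      rw [Ideal.span_le]
      intro a ha
      obtain ⟨s, hs, hsx⟩ := hx a ha
      obtain ⟨n, hn⟩ := mem_powAdd.1 hs
      refine ⟨n, ?_⟩
      rw [← add_sub_cancel s (a ^ n)]
      exact Submodule.add_mem_sup (hp s hsx) hn
    obtain ⟨n, hn⟩ := Ideal.exists_pow_le_of_le_radical_of_fg hle ⟨t, rfl⟩
    exact ⟨n + 1, by lia, (Ideal.pow_le_pow_right (Nat.le_succ n)).trans hn⟩

theorem torsion_span_eq_listTorsion (M : Type u) [AddCommGroup M] [Module R M] (t : Finset R)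
    (J : Ideal R) : torsion (Ideal.span (t : Set R)) J M =
      listTorsion M (t.toList.map (powAdd J)) := by
  ext x
  rw [mem_torsion_span_iff, mem_listTorsion]
  simp

/-- If `I` is generated by `r` elements, then `H^i_{I,J}` vanishes for `i > r`. -/
theorem isZero_H_obj [IsNoetherianRing R] (t : Finset R) (J : Ideal R) (M : ModuleCat.{u} R)
    (i : ℕ) (hi : t.card < i) : Limits.IsZero ((H (Ideal.span (t : Set R)) J i).obj M) := by
  obtain ⟨E⟩ := HasInjectiveResolution.out (Z := M)
  obtain ⟨i, rfl⟩ : ∃ k, i = k + 1 := ⟨i - 1, by lia⟩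
  refine Limits.IsZero.of_iso ?_ (E.isoRightDerivedObj (torsionFunctor _ J) (i + 1))
  refine (HomologicalComplex.exactAt_iff_isZero_homology _ _).1 ?_
  rw [HomologicalComplex.exactAt_iff' _ i (i + 1) (i + 1 + 1) (by simp) (by simp),
    ShortComplex.moduleCat_exact_iff]
  rintro ⟨x, hxt⟩ hx
  have hx' : (E.cocomplex.d (i + 1) (i + 1 + 1)).hom x = 0 := congrArg Subtype.val hx
  rw [torsion_span_eq_listTorsion] at hxt
  obtain ⟨y, hyt, hy⟩ := exists_mem_listTorsion_of_exact
    (fun n => (E.cocomplex.d n (n + 1)).hom)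
    (fun n => Module.Baer.of_injective
      ((Module.injective_iff_injective_object R _).2 (E.injective n)))
    (fun n x => by
      rw [← ModuleCat.comp_apply, E.cocomplex.d_comp_d]; rfl)
    (fun n x hx => (ShortComplex.moduleCat_exact_iff _).1 (E.exact_succ n) x hx)
    (t.toList.map (powAdd J)) i (by simpa using Nat.le_of_lt_succ hi) x hxt hx'
  rw [← torsion_span_eq_listTorsion] at hyt
  exact ⟨⟨y, hyt⟩, Subtype.ext hy⟩

end Vanishing

end PairCohomology

/-! ### Reduction to prime cyclic modules -/

namespace PairCohomology

open TensorProduct in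
/-- A finite module maps nontrivially to `R ⧸ p` for each `p` in its support: by Nakayama its fibre
at `p` is nonzero, and clearing denominators in a nonzero functional on the fibre gives the map. -/
theorem exists_linearMap_quotient_ne_zero {R : Type*} [CommRing R] {M : Type*} [AddCommGroup M]
    [Module R M] [Module.Finite R M] {p : PrimeSpectrum R} (hp : p ∈ Module.support R M) :
    ∃ f : M →ₗ[R] R ⧸ p.asIdeal, f ≠ 0 := by
  let K := p.asIdeal.ResidueField
  have : Nontrivial (K ⊗[R] M) :=
    (Module.mem_support_iff_nontrivial_residueField_tensorProduct p).1 hp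
  obtain ⟨v, hv⟩ := exists_ne (0 : K ⊗[R] M)
  obtain ⟨φ, hφ⟩ : ∃ φ : Module.Dual K (K ⊗[R] M), φ v ≠ 0 := by
    by_contra! h
    exact hv ((Module.forall_dual_apply_eq_zero_iff K v).1 h)
  let ψ : M →ₗ[R] K := (φ.restrictScalars R).comp (TensorProduct.mk R K M 1)
  have hψ : ∃ m, ψ m ≠ 0 := by
    by_contra! h
    apply hφ
    induction v using TensorProduct.induction_on with
    | zero => exact map_zero _
    | tmul c m =>
      have : c ⊗ₜ[R] m = c • ((1 : K) ⊗ₜ[R] m) := by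
        rw [TensorProduct.smul_tmul', smul_eq_mul, mul_one]
      rw [this, map_smul, show φ ((1 : K) ⊗ₜ[R] m) = 0 from h m, smul_zero]
    | add x y hx hy =>
      by_cases hx0 : φ x = 0
      · by_cases hy0 : φ y = 0
        · rw [map_add, hx0, hy0, add_zero]
        · exact absurd (hy (fun h => hy0 (by rw [h, map_zero])) hy0) hy0
      · exact absurd (hx (fun h => hx0 (by rw [h, map_zero])) hx0) hx0
  obtain ⟨m, hm⟩ := hψ
  obtain ⟨t, ht⟩ := Module.Finite.fg_top (R := R) (M := M)
  classical
  obtain ⟨⟨b, hb⟩, hbt⟩ := IsLocalization.exist_integer_multiples_of_finset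
    (nonZeroDivisors (R ⧸ p.asIdeal)) (t.image ψ)
  obtain ⟨b, rfl⟩ := Ideal.Quotient.mk_surjective b
  let L : (R ⧸ p.asIdeal) →ₗ[R] K := (Algebra.linearMap (R ⧸ p.asIdeal) K).restrictScalars R
  have hL : Function.Injective L := IsFractionRing.injective (R ⧸ p.asIdeal) K
  have hsmul : ∀ k : K, b • k = (Ideal.Quotient.mk p.asIdeal b) • k := fun k =>
    (algebraMap_smul (R ⧸ p.asIdeal) b k).symm
  have hmem : ∀ y, (b • ψ) y ∈ LinearMap.range L := by
    intro y
    have hy : y ∈ Submodule.span R (t : Set M) := ht ▸ trivial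
    have hle : Submodule.span R (t : Set M) ≤ (LinearMap.range L).comap (b • ψ) := by
      rw [Submodule.span_le]
      intro z hz
      obtain ⟨c, hc⟩ := hbt _ (Finset.mem_image_of_mem ψ hz)
      exact ⟨c, hc.trans (hsmul _).symm⟩
    exact hle hy
  refine ⟨(LinearEquiv.ofInjective L hL).symm.toLinearMap.comp ((b • ψ).codRestrict _ hmem),
    fun h => hm ?_⟩
  have h0 : (b • ψ).codRestrict _ hmem m = 0 :=
    (LinearEquiv.ofInjective L hL).symm.map_eq_zero_iff.1 (LinearMap.congr_fun h m)
  have h1 : b • ψ m = 0 := congrArg Subtype.val h0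
  rw [hsmul, Algebra.smul_def, mul_eq_zero] at h1
  refine h1.resolve_left fun h2 => ?_
  exact nonZeroDivisors.ne_zero hb
    ((map_eq_zero_iff _ (IsFractionRing.injective (R ⧸ p.asIdeal) K)).1 h2)

variable {R : Type u} [CommRing R] (I J : Ideal R)
  (S : ObjectProperty (ModuleCat.{u} R)) [S.IsSerreClass]

theorem isZero_H_obj_of_subsingleton (i : ℕ) (N : ModuleCat.{u} R) [Subsingleton N] :
    Limits.IsZero ((H I J i).obj N) := by
  have hN : Limits.IsZero N := ModuleCat.isZero_of_subsingleton N
  have := hN.injective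
  refine Limits.IsZero.of_iso ?_
    ((InjectiveResolution.self N).isoRightDerivedObj (torsionFunctor I J) i)
  exact Functor.map_isZero _ (Functor.map_isZero _
    (Functor.map_isZero (CochainComplex.single₀ _) hN))

theorem prop_H_of_exact (i : ℕ) {A B C : Type u} [AddCommGroup A] [Module R A]
    [AddCommGroup B] [Module R B] [AddCommGroup C] [Module R C] (f : A →ₗ[R] B) (g : B →ₗ[R] C)
    (hf : Function.Injective f) (hg : Function.Surjective g) (hfg : Function.Exact f g)
    (hA : S ((H I J i).obj (ModuleCat.of R A))) (hC : S ((H I J i).obj (ModuleCat.of R C))) :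
    S ((H I J i).obj (ModuleCat.of R B)) :=
  (torsionFunctor I J).prop_rightDerived_X₂ S
    (ModuleCat.shortComplex_shortExact (ShortComplex.mk (ModuleCat.ofHom f) (ModuleCat.ofHom g)
      (ModuleCat.hom_ext hfg.linearMap_comp_eq_zero)) hfg hf hg) i hA hC

theorem prop_H_of_surjective (i : ℕ) {B C : Type u}
    [AddCommGroup B] [Module R B] [AddCommGroup C] [Module R C] (g : B →ₗ[R] C)
    (hg : Function.Surjective g) (hB : S ((H I J i).obj (ModuleCat.of R B)))
    (hA : S ((H I J (i + 1)).obj (ModuleCat.of R (LinearMap.ker g)))) :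
    S ((H I J i).obj (ModuleCat.of R C)) :=
  (torsionFunctor I J).prop_rightDerived_X₃ S
    (ModuleCat.shortComplex_shortExact (ShortComplex.mk
      (ModuleCat.ofHom (LinearMap.ker g).subtype) (ModuleCat.ofHom g)
      (ModuleCat.hom_ext g.exact_subtype_ker_map.linearMap_comp_eq_zero))
      g.exact_subtype_ker_map Subtype.val_injective hg) i hB hA

theorem mem_support_quotient (p : PrimeSpectrum R) (q : PrimeSpectrum R) :
    q ∈ Module.support R (R ⧸ p.asIdeal) ↔ p ≤ q := by
  rw [Module.mem_support_iff_of_finite, Ideal.annihilator_quotient]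
  rfl

variable [IsNoetherianRing R]

/-- Dévissage along a prime filtration of `N`. -/
theorem prop_H_of_forall_mem_support (i : ℕ) (N : Type u) [AddCommGroup N] [Module R N]
    [hN : Module.Finite R N]
    (h : ∀ p ∈ Module.support R N, S ((H I J i).obj (ModuleCat.of R (R ⧸ p.asIdeal)))) :
    S ((H I J i).obj (ModuleCat.of R N)) := by
  revert h
  induction hN using IsNoetherianRing.induction_on_isQuotientEquivQuotientPrime with
  | subsingleton N =>
    exact fun _ => S.prop_of_isZero (isZero_H_obj_of_subsingleton I J i (ModuleCat.of R N))
  | quotient N p e =>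
    intro h
    refine S.prop_of_iso ((H I J i).mapIso e.symm.toModuleIso) (h p ?_)
    rw [e.support_eq]
    exact (mem_support_quotient p p).2 le_rfl
  | exact N₁ N₂ N₃ f g hf hg hfg h₁ h₃ =>
    intro h
    rw [Module.support_of_exact hfg hf hg] at h
    exact prop_H_of_exact I J S i f g hf hg hfg (h₁ fun p hp => h p (Or.inl hp))
      (h₃ fun p hp => h p (Or.inr hp))

/-- If `H^(i+1)` lies in `S` on all finite modules supported in `Supp M`, then `H^i` is right exact
up to `S` on them, and `H^i(M) ∈ S` propagates to `H^i(R ⧸ p)` for all `p ∈ Supp M`. The proof is a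
Noetherian induction on `p`, through the image of a nonzero map `M → R ⧸ p`. -/
theorem prop_H_quotient_of_mem_support (i : ℕ) (M : Type u) [AddCommGroup M] [Module R M]
    [Module.Finite R M] (hM : S ((H I J i).obj (ModuleCat.of R M)))
    (hS : ∀ (N : Type u) [AddCommGroup N] [Module R N] [Module.Finite R N],
      Module.support R N ⊆ Module.support R M → S ((H I J (i + 1)).obj (ModuleCat.of R N)))
    (p : PrimeSpectrum R) (hp : p ∈ Module.support R M) :
    S ((H I J i).obj (ModuleCat.of R (R ⧸ p.asIdeal))) := by
  have : WellFoundedGT (PrimeSpectrum R) :=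
    StrictMono.wellFoundedGT (f := PrimeSpectrum.asIdeal) fun _ _ h => h
  induction p using WellFoundedGT.induction with
  | ind p ih =>
  obtain ⟨f, hf⟩ := exists_linearMap_quotient_ne_zero hp
  have hrange : S ((H I J i).obj (ModuleCat.of R (LinearMap.range f))) :=
    prop_H_of_surjective I J S i f.rangeRestrict f.surjective_rangeRestrict hM
      (hS _ (Module.support_subset_of_injective (LinearMap.ker f.rangeRestrict).subtype
        Subtype.val_injective))
  refine prop_H_of_exact I J S i (LinearMap.range f).subtype (LinearMap.range f).mkQ
    Subtype.val_injective (Submodule.mkQ_surjective _)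
    (LinearMap.exact_subtype_mkQ _) hrange ?_
  refine prop_H_of_forall_mem_support I J S i _ fun q hq => ?_
  have hpq : p ≤ q := (mem_support_quotient p q).1
    (Module.support_subset_of_surjective _ (Submodule.mkQ_surjective _) hq)
  refine ih q (lt_of_le_of_ne hpq ?_) (Module.mem_support_mono hpq hp)
  rintro rfl
  -- A nonzero element of the ideal `range f` of `R ⧸ p` lifts to an element outside `p` that
  -- annihilates the cokernel of `f`.
  obtain ⟨m, hm⟩ : ∃ m, f m ≠ 0 := by
    by_contra! h
    exact hf (LinearMap.ext h)
  obtain ⟨r, hr⟩ := Ideal.Quotient.mk_surjective (f m)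
  have hrp : r ∉ p.asIdeal := fun h => hm (by rw [← hr, Ideal.Quotient.eq_zero_iff_mem.2 h])
  refine hrp (Module.annihilator_le_of_mem_support hq (Module.mem_annihilator.2 fun x => ?_))
  obtain ⟨y, rfl⟩ := Submodule.mkQ_surjective _ x
  obtain ⟨s, rfl⟩ := Ideal.Quotient.mk_surjective y
  rw [← map_smul, Submodule.mkQ_apply, Submodule.Quotient.mk_eq_zero]
  refine ⟨s • m, ?_⟩
  rw [map_smul, ← hr, Algebra.smul_def, Algebra.smul_def, mul_comm]
  rfl

/-- Membership of `H^i(M)` in `S` for all `i > n` depends on `Supp M` only, and passes to smaller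
supports. The proof is a descending induction on `i`, which starts in the range of vanishing. -/
theorem prop_H_of_support_subset (n : ℕ) (M : Type u) [AddCommGroup M] [Module R M]
    [Module.Finite R M] (hM : ∀ i, n < i → S ((H I J i).obj (ModuleCat.of R M)))
    (i : ℕ) (hi : n < i) (N : Type u) [AddCommGroup N] [Module R N] [Module.Finite R N]
    (hN : Module.support R N ⊆ Module.support R M) :
    S ((H I J i).obj (ModuleCat.of R N)) := by
  obtain ⟨t, rfl⟩ := IsNoetherian.noetherian I
  have key : ∀ k i, n < i → t.card < i + k → ∀ (N : Type u) [AddCommGroup N] [Module R N]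
      [Module.Finite R N], Module.support R N ⊆ Module.support R M →
      S ((H (Ideal.span (t : Set R)) J i).obj (ModuleCat.of R N)) := by
    intro k
    induction k with
    | zero => exact fun i _ hi N _ _ _ _ => S.prop_of_isZero (isZero_H_obj t J _ i hi)
    | succ k ih =>
      intro i hi hik N _ _ _ hN
      exact prop_H_of_forall_mem_support _ J S i N fun p hp =>
        prop_H_quotient_of_mem_support _ J S i M (hM i hi)
          (fun N _ _ _ hN => ih (i + 1) (by lia) (by lia) N hN) p (hN hp)
  exact key (t.card + 1) i hi (by lia) N hN

end PairCohomology

theorem theorem4p1 {R : Type u} [CommRing R] [IsNoetherianRing R] (I J : Ideal R)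
    (S : ObjectProperty (ModuleCat.{u} R)) [S.IsSerreClass]
    (M : Type u) [AddCommGroup M] [Module R M] [Module.Finite R M] (n : ℕ) :
    List.TFAE [
      ∀ i : ℕ, n < i → S ((PairCohomology.H I J i).obj (ModuleCat.of R M)),
      ∀ i : ℕ, n < i → ∀ (N : Type u) [AddCommGroup N] [Module R N] [Module.Finite R N],
        Module.support R N ⊆ Module.support R M →
          S ((PairCohomology.H I J i).obj (ModuleCat.of R N)),
      ∀ p : PrimeSpectrum R, p ∈ Module.support R M →
        ∀ i : ℕ, n < i → S ((PairCohomology.H I J i).obj (ModuleCat.of R (R ⧸ p.asIdeal))),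
      ∀ p : Ideal R, Minimal (fun q : Ideal R => q ∈ associatedPrimes R M) p →
        ∀ i : ℕ, n < i → S ((PairCohomology.H I J i).obj (ModuleCat.of R (R ⧸ p)))] := by
  tfae_have 1 → 2 := fun h i hi N _ _ _ hN =>
    PairCohomology.prop_H_of_support_subset I J S n M h i hi N hN
  tfae_have 2 → 3 := fun h p hp i hi => h i hi _ fun q hq =>
    Module.mem_support_mono ((PairCohomology.mem_support_quotient p q).1 hq) hp
  tfae_have 3 → 1 := fun h i hi =>
    PairCohomology.prop_H_of_forall_mem_support I J S i M fun p hp => h p hp i hi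
  tfae_have 3 → 4 := fun h p hp i hi =>
    h ⟨p, hp.prop.isPrime⟩ (Module.mem_support_iff_of_finite.2
      (Submodule.annihilator_top.symm.trans_le hp.prop.annihilator_le)) i hi
  tfae_have 4 → 3 := fun h p hp i hi => by
    obtain ⟨q, hq, hqp⟩ :=
      Ideal.exists_minimalPrimes_le (Module.mem_support_iff_of_finite.1 hp)
    have hmin : Minimal (fun q : Ideal R => q ∈ associatedPrimes R M) q :=
      ⟨Module.associatedPrimes.minimalPrimes_annihilator_subset_associatedPrimes R M hq,
        fun q' hq' hle => hq.2 ⟨hq'.isPrime,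
          Submodule.annihilator_top.symm.trans_le hq'.annihilator_le⟩ hle⟩
    refine PairCohomology.prop_H_of_support_subset I J S n (R ⧸ q) (h q hmin) i hi _
      fun r hr => ?_
    exact (PairCohomology.mem_support_quotient ⟨q, hq.1.1⟩ r).2
      (le_trans hqp ((PairCohomology.mem_support_quotient p r).1 hr))
  tfae_finish
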